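/- Let $d\ge 2$, $1\le i\le d-1$ and $N\ge 1$ be integers, let $\mathbb F$ be a field, and let $p\in[0,1]$ and $q\in(0,\infty)$. Let $\mathbb T^d_N$ be the cubical complex obtained by dividing $[0,N]^d$ into unit cubes and identifying opposite faces of $[0,N]^d$, and let $F^i_N$ be the set of its $i$-plaquettes (its $i$-dimensional cubes). For a subcomplex $P$ of $\mathbb T^d_N$ let $\mathbf b_k(P)=\dim_{\mathbb F} H_k(P;\mathbb F)$, let $b_k(P)$ be the rank of the map $H_k(P;\mathbb F)\to H_k(\mathbb T^d_N;\mathbb F)$ induced by the inclusion (the number of giant $k$-cycles), and let $\eta(P)$ be the number of $i$-plaquettes of $P$. The balanced $i$-dimensional plaquette random-cluster model $\tilde\mu_{\mathbb T^d_N,p,q,i}$ is the law of the random $i$-complex $P$ that consists of the full $(i-1)$-skeleton of $\mathbb T^d_N$ and a random set of $i$-plaquettes, with $$\tilde\mu_{\mathbb T^d_N,p,q,i}(P)=\frac{1}{\tilde Z}\,(\sqrt q)^{-b_i(P)}\,p^{\eta(P)}(1-p)^{|F^i_N|-\eta(P)}\,q^{\mathbf b_{i-1}(P)},$$ where $\tilde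 Z$ is the normalizing constant. Let $(\mathbb T^d_N)^\bullet$ be the complex $\mathbb T^d_N$ shifted by $1/2$ in each coordinate direction. Each $k$-plaquette of $\mathbb T^d_N$ meets exactly one $(d-k)$-plaquette of $(\mathbb T^d_N)^\bullet$, its dual plaquette. For a subcomplex $P$ of $\mathbb T^d_N$ let $P^\bullet$ be the subcomplex of $(\mathbb T^d_N)^\bullet$ made of all plaquettes whose dual plaquette is not in $P$. **Theorem.** If $P$ has law $\tilde\mu_{\mathbb T^d_N,p,q,i}$, then $P^\bullet$, viewed as a subcomplex of $\mathbb T^d_N$ through the shift, has law $\tilde\mu_{\mathbb T^d_N,p^*,q,d-i}$, where $$p^*=\frac{(1-p)q}{(1-p)q+p}.$$ -/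

import Mathlib

open scoped ENNReal

noncomputable section

namespace PlaquetteRC

/-! ### The cubical complex `T^d_N` and its dual -/

/-- Plaquettes (cells) of the torus `(ℝ / N ℤ)^d`, cut into unit cubes with corners in the integer
lattice. The pair `(v, S)` is the cube `∏ j, I j` with `I j = [v j, v j + 1]` for `j ∈ S` and
`I j = {v j}` for `j ∉ S`; its dimension is the number of elements of `S`. -/
abbrev Plaquette (d N : ℕ) : Type := (Fin d → ZMod N) × Finset (Fin d)

/-- The dimension of a plaquette. -/
def Plaquette.dim {d N : ℕ} (σ : Plaquette d N) : ℕ := σ.2.card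

/-- The face of `σ` on which the coordinate `k` takes its smaller value (used for `k ∈ σ.2`). -/
def Plaquette.lower {d N : ℕ} (σ : Plaquette d N) (k : Fin d) : Plaquette d N :=
  (σ.1, σ.2.erase k)

/-- The face of `σ` on which the coordinate `k` takes its larger value (used for `k ∈ σ.2`). -/
def Plaquette.upper {d N : ℕ} (σ : Plaquette d N) (k : Fin d) : Plaquette d N :=
  (σ.1 + Pi.single k 1, σ.2.erase k)

/-- The closed subset of the torus `(ℝ / N ℤ)^d` that is occupied by the plaquette with label
`(v, S)`, translated by `s` in each coordinate direction. The complex `T^d_N` is the case `s = 0`,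
the dual complex `(T^d_N)^•` is the case `s = 1 / 2`. -/
def Plaquette.carrier {d N : ℕ} (s : ℝ) (σ : Plaquette d N) : Set (Fin d → AddCircle (N : ℝ)) :=
  {x | ∀ j, ∃ t : ℝ, (σ.1 j).val + s ≤ t ∧ t ≤ (σ.1 j).val + s + (if j ∈ σ.2 then 1 else 0) ∧
    x j = (t : AddCircle (N : ℝ))}

/-- The dual plaquette of a plaquette of `T^d_N`: the plaquette of complementary dimension of
`(T^d_N)^•` with the same centre. Plaquettes of `(T^d_N)^•` are labelled by those of `T^d_N`,
through the translation by `1 / 2` in each coordinate direction: the label `(w, T)` stands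
for the translate of the cube `(w, T)`. -/
def dualPlaquette {d N : ℕ} (σ : Plaquette d N) : Plaquette d N :=
  (fun j => if j ∈ σ.2 then σ.1 j else σ.1 j - 1, σ.2ᶜ)

/-- The plaquette of `T^d_N` that is matched with a given plaquette of `(T^d_N)^•`; the inverse of
`dualPlaquette`. -/
def primalPlaquette {d N : ℕ} (τ : Plaquette d N) : Plaquette d N :=
  (fun j => if j ∈ τ.2 then τ.1 j + 1 else τ.1 j, τ.2ᶜ)

theorem primalPlaquette_dualPlaquette {d N : ℕ} (σ : Plaquette d N) :
    primalPlaquette (dualPlaquette σ) = σ := by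
  refine Prod.ext (funext fun j => ?_) (by simp [primalPlaquette, dualPlaquette])
  by_cases h : j ∈ σ.2 <;> simp [primalPlaquette, dualPlaquette, h]

theorem dualPlaquette_primalPlaquette {d N : ℕ} (τ : Plaquette d N) :
    dualPlaquette (primalPlaquette τ) = τ := by
  refine Prod.ext (funext fun j => ?_) (by simp [primalPlaquette, dualPlaquette])
  by_cases h : j ∈ τ.2 <;> simp [primalPlaquette, dualPlaquette, h]

/-- The dual plaquette of an `i`-plaquette `σ` is the only `(d - i)`-plaquette of the dual complex
`(T^d_N)^•` that meets `σ`. -/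
theorem carrier_inter_nonempty_iff {d N : ℕ} [NeZero N] (σ τ : Plaquette d N)
    (h : σ.dim + τ.dim = d) :
    (σ.carrier 0 ∩ τ.carrier (1 / 2)).Nonempty ↔ τ = dualPlaquette σ := by
  have key : ∀ (s t : ℝ), (s : AddCircle (N : ℝ)) = (t : AddCircle (N : ℝ)) →
      ∃ m : ℤ, t - s = m * N := by
    intro s t hst
    obtain ⟨m, hm⟩ := (AddCircle.coe_eq_zero_iff (N : ℝ)).1
      (show ((t - s : ℝ) : AddCircle (N : ℝ)) = 0 by rw [AddCircle.coe_sub, hst, sub_self])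
    exact ⟨m, by rw [← hm]; simp⟩
  have cast : ∀ (a b : ZMod N) (c m : ℤ), (b.val : ℤ) = a.val + c + m * N → b = a + c := by
    intro a b c m hm
    have := congrArg (fun z : ℤ => (z : ZMod N)) hm
    simpa using this
  constructor
  · rintro ⟨x, hx, hy⟩
    have cover : ∀ j, j ∈ σ.2 ∨ j ∈ τ.2 := by
      intro j
      by_contra! hj
      obtain ⟨t, h1, h2, h3⟩ := hx j
      obtain ⟨u, h4, h5, h6⟩ := hy j
      simp only [hj.1, hj.2, if_false] at h2 h5
      obtain ⟨m, hm⟩ := key t u (h3.symm.trans h6)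
      have e : (2 * (τ.1 j).val + 1 : ℝ) = 2 * (σ.1 j).val + 2 * (m * N) := by linarith
      have e' : (2 * (τ.1 j).val + 1 : ℤ) = 2 * (σ.1 j).val + 2 * (m * N) := by exact_mod_cast e
      omega
    have hcompl : τ.2 = σ.2ᶜ := by
      symm
      apply Finset.eq_of_subset_of_card_le
      · intro j hj
        exact (cover j).resolve_left (Finset.mem_compl.1 hj)
      · rw [Finset.card_compl, Fintype.card_fin]
        simp only [Plaquette.dim] at h
        omega
    refine Prod.ext (funext fun j => ?_) hcompl
    obtain ⟨t, h1, h2, h3⟩ := hx j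
    obtain ⟨u, h4, h5, h6⟩ := hy j
    obtain ⟨m, hm⟩ := key t u (h3.symm.trans h6)
    by_cases hj : j ∈ σ.2
    · have hj' : j ∉ τ.2 := by simp [hcompl, hj]
      simp only [hj, hj', if_true, if_false] at h2 h5
      have e1 : ((τ.1 j).val : ℝ) < (σ.1 j).val + m * N + 1 := by linarith
      have e2 : ((σ.1 j).val + m * N : ℝ) < (τ.1 j).val + 1 := by linarith
      have e1' : ((τ.1 j).val : ℤ) < (σ.1 j).val + m * N + 1 := by exact_mod_cast e1
      have e2' : ((σ.1 j).val + m * N : ℤ) < (τ.1 j).val + 1 := by exact_mod_cast e2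
      have := cast (σ.1 j) (τ.1 j) 0 m (by omega)
      simpa [dualPlaquette, hj] using this
    · have hj' : j ∈ τ.2 := by simp [hcompl, hj]
      simp only [hj, hj', if_true, if_false] at h2 h5
      have e1 : ((τ.1 j).val : ℝ) < (σ.1 j).val + m * N := by linarith
      have e2 : ((σ.1 j).val + m * N : ℝ) < (τ.1 j).val + 2 := by linarith
      have e1' : ((τ.1 j).val : ℤ) < (σ.1 j).val + m * N := by exact_mod_cast e1
      have e2' : ((σ.1 j).val + m * N : ℤ) < (τ.1 j).val + 2 := by exact_mod_cast e2
      have := cast (σ.1 j) (τ.1 j) (-1) m (by omega)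
      simpa [dualPlaquette, hj, sub_eq_add_neg] using this
  · rintro rfl
    refine ⟨fun j => (((σ.1 j).val + (if j ∈ σ.2 then 1 / 2 else 0) : ℝ) : AddCircle (N : ℝ)),
      fun j => ⟨_, ?_, ?_, rfl⟩, fun j => ?_⟩
    · split_ifs <;> norm_num
    · split_ifs <;> norm_num
    · by_cases hj : j ∈ σ.2
      · refine ⟨(σ.1 j).val + 1 / 2, ?_, ?_, ?_⟩ <;> simp [dualPlaquette, hj]
      · obtain ⟨m, hm⟩ : ∃ m : ℤ, ((σ.1 j).val : ℤ) = (σ.1 j - 1).val + 1 + m * N := by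
          have : (((σ.1 j).val - ((σ.1 j - 1).val + 1) : ℤ) : ZMod N) = 0 := by
            push_cast; simp
          obtain ⟨m, hm⟩ := (ZMod.intCast_zmod_eq_zero_iff_dvd _ N).1 this
          exact ⟨m, by linarith⟩
        have hm' : ((σ.1 j).val : ℝ) = (σ.1 j - 1).val + 1 + m * N := by exact_mod_cast hm
        refine ⟨(σ.1 j).val - m * N, ?_, ?_, ?_⟩
        · simp only [dualPlaquette, hj, if_false]; linarith
        · simp only [dualPlaquette, hj, if_false, Finset.mem_compl, not_false_eq_true, if_true]
          linarith
        · simp only [hj, if_false, add_zero]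
          rw [← sub_eq_zero, ← AddCircle.coe_sub, AddCircle.coe_eq_zero_iff]
          exact ⟨m, by simp⟩

/-- Subcomplexes of `T^d_N`: sets of plaquettes that contain all faces of their elements. -/
@[ext]
structure Subcomplex (d N : ℕ) where
  cells : Set (Plaquette d N)
  lower_mem : ∀ σ ∈ cells, ∀ k ∈ σ.2, σ.lower k ∈ cells
  upper_mem : ∀ σ ∈ cells, ∀ k ∈ σ.2, σ.upper k ∈ cells

/-- The complex `T^d_N` itself. -/
def fullComplex (d N : ℕ) : Subcomplex d N where
  cells := Set.univ
  lower_mem _ _ _ _ := trivial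
  upper_mem _ _ _ _ := trivial

/-- The dual complex `P^•`, the subcomplex of `(T^d_N)^•` made of all plaquettes whose dual
plaquette is not in `P`. Like `(T^d_N)^•`, it is labelled through the translation by `1 / 2` in each
coordinate direction. -/
def Subcomplex.dual {d N : ℕ} (P : Subcomplex d N) : Subcomplex d N where
  cells := {τ | primalPlaquette τ ∉ P.cells}
  lower_mem τ hτ k hk hmem := by
    apply hτ
    have h := P.upper_mem _ hmem k (by simp [primalPlaquette, Plaquette.lower])
    convert h using 1
    refine Prod.ext (funext fun j => ?_) ?_
    · by_cases hj : j = k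
      · subst hj; simp [primalPlaquette, Plaquette.lower, Plaquette.upper, hk]
      · simp [primalPlaquette, Plaquette.lower, Plaquette.upper, hj]
    · ext j
      by_cases hj : j = k
      · subst hj; simp [primalPlaquette, Plaquette.upper, hk]
      · simp [primalPlaquette, Plaquette.lower, Plaquette.upper, hj]
  upper_mem τ hτ k hk hmem := by
    apply hτ
    have h := P.lower_mem _ hmem k (by simp [primalPlaquette, Plaquette.upper])
    convert h using 1
    refine Prod.ext (funext fun j => ?_) ?_
    · by_cases hj : j = k
      · subst hj; simp [primalPlaquette, Plaquette.lower, Plaquette.upper, hk]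
      · simp [primalPlaquette, Plaquette.lower, Plaquette.upper, hj]
    · ext j
      by_cases hj : j = k
      · subst hj; simp [primalPlaquette, Plaquette.lower, hk]
      · simp [primalPlaquette, Plaquette.lower, Plaquette.upper, hj]

/-! ### Cubical homology -/

section Homology

variable (F : Type*) [Field F] {d N : ℕ}

/-- The boundary of a plaquette: if `k` is the `l`-th smallest element of `S`, then the faces in
direction `k` have the sign `(-1) ^ (l - 1)`, and `l - 1` is the number of `m ∈ S` with `m < k`.
Chains of the finite complex `T^d_N` are functions from plaquettes to `F`; `Pi.single σ 1` is the
plaquette `σ`, seen as a chain. -/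
def plaquetteBoundary (σ : Plaquette d N) : Plaquette d N → F :=
  ∑ k ∈ σ.2, (-1 : F) ^ (σ.2.filter (· < k)).card •
    (Pi.single (σ.upper k) 1 - Pi.single (σ.lower k) 1)

/-- The `k`-chains `C_k(X; F)`, as a subspace of the chains of `T^d_N`. -/
def chains (X : Subcomplex d N) (k : ℕ) : Submodule F (Plaquette d N → F) where
  carrier := {c | ∀ σ, c σ ≠ 0 → σ ∈ X.cells ∧ σ.dim = k}
  zero_mem' σ h := absurd rfl h
  add_mem' {a b} ha hb σ h := by
    by_cases h0 : a σ = 0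
    · exact hb σ (by simpa [h0] using h)
    · exact ha σ h0
  smul_mem' r a ha σ h := ha σ (right_ne_zero_of_mul h)

theorem chains_mono {X Y : Subcomplex d N} (h : X.cells ⊆ Y.cells) (k : ℕ) :
    chains F X k ≤ chains F Y k :=
  fun _ hc σ hσ => ⟨h (hc σ hσ).1, (hc σ hσ).2⟩

variable [NeZero N]

/-- The boundary operator on the chains of `T^d_N` (of all dimensions together). -/
def boundary : (Plaquette d N → F) →ₗ[F] (Plaquette d N → F) :=
  Fintype.linearCombination F (plaquetteBoundary F)

theorem boundary_single (σ : Plaquette d N) :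
    boundary F (Pi.single σ 1) = plaquetteBoundary F σ := by
  simp [boundary]

theorem boundary_boundary (c : Plaquette d N → F) : boundary F (boundary F c) = 0 := by
  suffices h : (boundary F).comp (boundary F) = (0 : (Plaquette d N → F) →ₗ[F] _) from
    LinearMap.congr_fun h c
  refine LinearMap.pi_ext' fun σ => LinearMap.ext_ring ?_
  simp only [LinearMap.comp_apply, LinearMap.single_apply, LinearMap.zero_apply, boundary_single]
  simp only [plaquetteBoundary, map_sum, map_smul, map_sub, boundary_single]
  let f : Fin d × Fin d → Plaquette d N → F := fun x =>
    (-1 : F) ^ (σ.2.filter (· < x.1)).card • (-1 : F) ^ ((σ.2.erase x.1).filter (· < x.2)).card •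
      ((Pi.single ((σ.upper x.1).upper x.2) 1 - Pi.single ((σ.upper x.1).lower x.2) 1) -
        (Pi.single ((σ.lower x.1).upper x.2) 1 - Pi.single ((σ.lower x.1).lower x.2) 1))
  have hf : ∀ k l : Fin d, k ∈ σ.2 → l ∈ σ.2 → k < l → f (k, l) + f (l, k) = 0 := by
    intro k l hk hl hkl
    have c1 : (σ.2.erase l).filter (· < k) = σ.2.filter (· < k) := by
      ext m; simp only [Finset.mem_filter, Finset.mem_erase]
      exact ⟨fun h => ⟨h.1.2, h.2⟩, fun h => ⟨⟨(h.2.trans hkl).ne, h.1⟩, h.2⟩⟩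
    have c2 : (σ.2.filter (· < l)).card = ((σ.2.erase k).filter (· < l)).card + 1 := by
      rw [Finset.filter_erase, Finset.card_erase_add_one]
      simp [hk, hkl]
    have u1 : (σ.upper l).upper k = (σ.upper k).upper l := by
      simp [Plaquette.upper, add_right_comm, Finset.erase_right_comm]
    have u2 : (σ.upper l).lower k = (σ.lower k).upper l := by
      simp [Plaquette.upper, Plaquette.lower, Finset.erase_right_comm]
    have u3 : (σ.lower l).upper k = (σ.upper k).lower l := by
      simp [Plaquette.upper, Plaquette.lower, Finset.erase_right_comm]
    have u4 : (σ.lower l).lower k = (σ.lower k).lower l := by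
      simp [Plaquette.lower, Finset.erase_right_comm]
    simp only [f, c1, c2, u1, u2, u3, u4]
    ext τ
    simp only [Pi.add_apply, Pi.smul_apply, Pi.sub_apply, smul_eq_mul, Pi.zero_apply, pow_succ]
    ring
  have hsum : ∑ x ∈ σ.2.offDiag, f x = 0 := by
    refine Finset.sum_involution (fun x _ => x.swap) ?_ ?_ ?_ ?_
    · rintro ⟨k, l⟩ hx
      rw [Finset.mem_offDiag] at hx
      rcases lt_or_gt_of_ne hx.2.2 with h | h
      · exact hf k l hx.1 hx.2.1 h
      · rw [add_comm]; exact hf l k hx.2.1 hx.1 h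
    · rintro ⟨k, l⟩ hx - h
      rw [Finset.mem_offDiag] at hx
      exact hx.2.2 (congrArg Prod.snd h)
    · rintro ⟨k, l⟩ hx
      rw [Finset.mem_offDiag] at hx ⊢
      exact ⟨hx.2.1, hx.1, hx.2.2.symm⟩
    · rintro ⟨k, l⟩ -; rfl
  rw [← hsum]
  have : σ.2.offDiag = σ.2.biUnion fun k => (σ.2.erase k).image fun l => (k, l) := by
    ext ⟨k, l⟩
    simp only [Finset.mem_offDiag, Finset.mem_biUnion, Finset.mem_image, Finset.mem_erase,
      Prod.mk.injEq]
    grind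
  rw [this, Finset.sum_biUnion]
  · refine Finset.sum_congr rfl fun k _ => ?_
    rw [Finset.sum_image (by simp)]
    simp only [f, Plaquette.upper, Plaquette.lower, ← Finset.sum_sub_distrib, ← smul_sub,
      Finset.smul_sum]
  · intro a _ b _ hab
    simp only [Function.onFun]
    rw [Finset.disjoint_left]
    rintro ⟨k, l⟩ h1 h2
    simp only [Finset.mem_image, Prod.mk.injEq] at h1 h2
    grind

/-- The `k`-cycles `Z_k(X; F)`. -/
def cycles (X : Subcomplex d N) (k : ℕ) : Submodule F (Plaquette d N → F) :=
  chains F X k ⊓ LinearMap.ker (boundary F)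

/-- The `k`-boundaries `B_k(X; F)`. -/
def boundaries (X : Subcomplex d N) (k : ℕ) : Submodule F (Plaquette d N → F) :=
  (chains F X (k + 1)).map (boundary F)

theorem boundaries_le_cycles (X : Subcomplex d N) (k : ℕ) :
    boundaries F X k ≤ cycles F X k := by
  rintro _ ⟨c, hc, rfl⟩
  refine ⟨fun τ hτ => ?_, boundary_boundary F c⟩
  rw [boundary, Fintype.linearCombination_apply, Finset.sum_apply] at hτ
  obtain ⟨σ, -, hσ⟩ := Finset.exists_ne_zero_of_sum_ne_zero hτ
  obtain ⟨hσX, hσk⟩ := hc σ (left_ne_zero_of_mul hσ)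
  have hσ' := right_ne_zero_of_mul hσ
  rw [plaquetteBoundary, Finset.sum_apply] at hσ'
  obtain ⟨j, hj, hj'⟩ := Finset.exists_ne_zero_of_sum_ne_zero hσ'
  have hdim : (σ.2.erase j).card = k := by
    rw [Finset.card_erase_of_mem hj]; simp only [Plaquette.dim] at hσk; omega
  by_cases h1 : τ = σ.upper j
  · subst h1; exact ⟨X.upper_mem σ hσX j hj, hdim⟩
  · by_cases h2 : τ = σ.lower j
    · subst h2; exact ⟨X.lower_mem σ hσX j hj, hdim⟩
    · simp [h1, h2] at hj'

theorem cycles_mono {X Y : Subcomplex d N} (h : X.cells ⊆ Y.cells) (k : ℕ) :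
    cycles F X k ≤ cycles F Y k :=
  inf_le_inf_right _ (chains_mono F h k)

theorem boundaries_mono {X Y : Subcomplex d N} (h : X.cells ⊆ Y.cells) (k : ℕ) :
    boundaries F X k ≤ boundaries F Y k :=
  Submodule.map_mono (chains_mono F h (k + 1))

/-- The homology `H_k(X; F) = Z_k(X; F) / B_k(X; F)`. -/
abbrev Homology (X : Subcomplex d N) (k : ℕ) : Type _ :=
  cycles F X k ⧸ (boundaries F X k).submoduleOf (cycles F X k)

/-- The Betti number `𝐛_k(X; F) = dim H_k(X; F)`. -/
def betti (X : Subcomplex d N) (k : ℕ) : ℕ := Module.finrank F (Homology F X k)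

/-- The map `H_k(X; F) → H_k(Y; F)` induced by an inclusion of complexes. -/
def homologyMap {X Y : Subcomplex d N} (h : X.cells ⊆ Y.cells) (k : ℕ) :
    Homology F X k →ₗ[F] Homology F Y k :=
  Submodule.mapQ _ _ (Submodule.inclusion (cycles_mono F h k))
    fun _ hx => boundaries_mono F h k hx

/-- The number `b_k(X; F)` of giant cycles: the rank of `H_k(X; F) → H_k(T^d_N; F)`. -/
def giantRank (X : Subcomplex d N) (k : ℕ) : ℕ :=
  Module.finrank F
    (LinearMap.range (homologyMap F (Y := fullComplex d N) (Set.subset_univ X.cells) k))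

end Homology

/-! ### The balanced plaquette random-cluster model -/

/-- The `i`-plaquettes of `T^d_N`. -/
abbrev Face (d N i : ℕ) : Type := {σ : Plaquette d N // σ.dim = i}

/-- The complex `P(ω)`: the union of the `(i - 1)`-skeleton of `T^d_N` and the set `ω` of open
`i`-plaquettes. -/
def complexOf {d N i : ℕ} (ω : Finset (Face d N i)) : Subcomplex d N where
  cells := {σ | σ.dim < i ∨ ∃ τ ∈ ω, τ.1 = σ}
  lower_mem := by
    rintro σ hσ k hk
    left
    have h1 : (σ.lower k).dim < σ.dim := Finset.card_erase_lt_of_mem hk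
    rcases hσ with h | ⟨τ, -, rfl⟩
    · exact h1.trans h
    · exact h1.trans_eq τ.2
  upper_mem := by
    rintro σ hσ k hk
    left
    have h1 : (σ.upper k).dim < σ.dim := Finset.card_erase_lt_of_mem hk
    rcases hσ with h | ⟨τ, -, rfl⟩
    · exact h1.trans h
    · exact h1.trans_eq τ.2

/-- The weight of a configuration in the balanced `i`-dimensional plaquette random-cluster model
(for `1 ≤ i`):
`(√q)^(-b_i(P)) * p^(η(P)) * (1 - p)^(|F^i_N| - η(P)) * q^(𝐛_{i-1}(P))` with `P = P(ω)`, where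
`η(P)` is the number of `i`-plaquettes of `P`. -/
def balancedWeight (F : Type*) [Field F] {d N i : ℕ} [NeZero N] (p q : ℝ)
    (ω : Finset (Face d N i)) : ℝ :=
  (√q)⁻¹ ^ giantRank F (complexOf ω) i * p ^ ω.card *
    (1 - p) ^ (Fintype.card (Face d N i) - ω.card) * q ^ betti F (complexOf ω) (i - 1)

theorem balancedWeight_nonneg (F : Type*) [Field F] {d N i : ℕ} [NeZero N] {p q : ℝ}
    (hp : p ∈ Set.Icc (0 : ℝ) 1) (hq : 0 < q) (ω : Finset (Face d N i)) :
    0 ≤ balancedWeight F p q ω := by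
  have h1 := hp.1
  have h2 := sub_nonneg.2 hp.2
  unfold balancedWeight
  positivity

theorem tsum_balancedWeight_ne_zero (F : Type*) [Field F] {d N i : ℕ} [NeZero N] {p q : ℝ}
    (hp : p ∈ Set.Icc (0 : ℝ) 1) (hq : 0 < q) :
    ∑' ω : Finset (Face d N i), ENNReal.ofReal (balancedWeight F p q ω) ≠ 0 := by
  have hs : 0 < √q := Real.sqrt_pos.2 hq
  intro h0
  rw [ENNReal.tsum_eq_zero] at h0
  rcases hp.1.eq_or_lt with h | h
  · have h1 := ENNReal.ofReal_eq_zero.1 (h0 ∅)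
    have : 0 < balancedWeight F p q (∅ : Finset (Face d N i)) := by
      simp only [balancedWeight, ← h, Finset.card_empty, sub_zero, one_pow, pow_zero, mul_one]
      positivity
    linarith
  · have h1 := ENNReal.ofReal_eq_zero.1 (h0 Finset.univ)
    have : 0 < balancedWeight F p q (Finset.univ : Finset (Face d N i)) := by
      simp only [balancedWeight, Finset.card_univ, Nat.sub_self, pow_zero, mul_one]
      positivity
    linarith

theorem tsum_balancedWeight_ne_top (F : Type*) [Field F] {d N i : ℕ} [NeZero N] (p q : ℝ) :
    ∑' ω : Finset (Face d N i), ENNReal.ofReal (balancedWeight F p q ω) ≠ ∞ := by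
  rw [tsum_fintype]
  exact ENNReal.sum_ne_top.2 fun _ _ => ENNReal.ofReal_ne_top

/-- The balanced `i`-dimensional plaquette random-cluster model on `T^d_N` with coefficients in `F`
and parameters `p ∈ [0, 1]`, `q ∈ (0, ∞)`: the law of the random complex `P(ω)` when the
configuration `ω` has probability proportional to `balancedWeight F p q ω`. -/
def balancedRCM (F : Type*) [Field F] (d N i : ℕ) [NeZero N] (p q : ℝ)
    (hp : p ∈ Set.Icc (0 : ℝ) 1) (hq : 0 < q) : PMF (Subcomplex d N) :=
  (PMF.normalize (fun ω : Finset (Face d N i) => ENNReal.ofReal (balancedWeight F p q ω))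
    (tsum_balancedWeight_ne_zero F hp hq) (tsum_balancedWeight_ne_top F p q)).map complexOf

/-- The dual parameter `p^* = (1 - p) q / ((1 - p) q + p)`. -/
def dualParam (p q : ℝ) : ℝ := (1 - p) * q / ((1 - p) * q + p)

theorem dualParam_mem {p q : ℝ} (hp : p ∈ Set.Icc (0 : ℝ) 1) (hq : 0 < q) :
    dualParam p q ∈ Set.Icc (0 : ℝ) 1 := by
  have h : 0 ≤ (1 - p) * q := mul_nonneg (sub_nonneg.2 hp.2) hq.le
  have h' : 0 ≤ (1 - p) * q + p := add_nonneg h hp.1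
  exact ⟨div_nonneg h h', div_le_one_of_le₀ (le_add_of_nonneg_right hp.1) h'⟩

end PlaquetteRC

end

/-!
The map `ω ↦ ω^•`, which opens a plaquette if and only if its dual plaquette is closed, is a bijection
between the configurations of `i`-plaquettes and those of `(d - i)`-plaquettes, and it describes
`P ↦ P^•` (`dual_complexOf`). So it suffices that it multiplies the weights by a constant
(`balancedWeight_dualConfig`, `normalize_map_equiv`), and by the choice of `p^*` this comes down to
two identities between ranks:

* `b_i(P) + b_{d-i}(P^•) = dim H_i(T^d_N)` (`giantRank_add_giantRank_dual`),
* `𝐛_{d-i-1}(P^•) + b_i(P) = 𝐛_{i-1}(P) + η(P) + const` (`betti_dual_add_giantRank`).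

No homology of the torus has to be computed, and no Alexander or Poincaré duality theorem is used.
The intersection pairing of `i`-chains of `T^d_N` with `(d - i)`-chains of the dual complex is perfect,
and with suitable signs the two boundary operators are adjoint (`intersectionForm_boundary`). Under
this pairing, annihilators are as follows: chains of `P` and chains of `P^•` (`chains_dual`),
boundaries and cycles of the torus (`cycles_full_eq`), cycles and boundaries of the torus
(`boundaries_full_eq`). Hence with `C`, `Z`, `B` for the chains of `P`, the cycles and the boundaries of
the torus in dimension `i`, the dimensions of the cycles of `P^•` and of its cycles that bound
in the torus are the codimensions of `C + B` and of `C + Z`. Both ranks are combinations of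
these dimensions.
-/

noncomputable section

namespace PlaquetteRC

/-! ### The intersection pairing -/

theorem dualPlaquette_eq_iff {d N : ℕ} {σ τ : Plaquette d N} :
    dualPlaquette σ = τ ↔ σ = primalPlaquette τ :=
  ⟨fun h => by rw [← h, primalPlaquette_dualPlaquette],
    fun h => by rw [h, dualPlaquette_primalPlaquette]⟩

theorem dim_add_dim_dualPlaquette {d N : ℕ} (σ : Plaquette d N) :
    σ.dim + (dualPlaquette σ).dim = d := by
  simp [Plaquette.dim, dualPlaquette]

theorem dim_add_dim_primalPlaquette {d N : ℕ} (τ : Plaquette d N) :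
    τ.dim + (primalPlaquette τ).dim = d := by
  simp [Plaquette.dim, primalPlaquette]

/-- Passing to the dual exchanges lower faces with upper cofaces. -/
theorem dualPlaquette_upper_eq_iff {d N : ℕ} {σ τ : Plaquette d N} {k : Fin d}
    (hσ : k ∈ σ.2) (hτ : k ∈ τ.2) :
    dualPlaquette (σ.upper k) = τ ↔ τ.lower k = dualPlaquette σ := by
  have hset : (σ.2.erase k)ᶜ = τ.2 ↔ τ.2.erase k = σ.2ᶜ := by
    simp only [Finset.ext_iff, Finset.mem_compl, Finset.mem_erase]
    refine forall_congr' fun j => ?_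
    by_cases hj : j = k
    · subst hj; simp [hσ, hτ]
    · simp [hj, iff_comm]
  simp only [dualPlaquette, Plaquette.upper, Plaquette.lower, Prod.ext_iff, hset]
  refine and_congr_left fun _ => ?_
  simp only [funext_iff]
  refine forall_congr' fun j => ?_
  by_cases hj : j = k
  · subst hj; simp [hσ, eq_comm]
  · simp [hj, eq_comm]

/-- Passing to the dual exchanges upper faces with lower cofaces. -/
theorem dualPlaquette_lower_eq_iff {d N : ℕ} {σ τ : Plaquette d N} {k : Fin d}
    (hσ : k ∈ σ.2) (hτ : k ∈ τ.2) :
    dualPlaquette (σ.lower k) = τ ↔ τ.upper k = dualPlaquette σ := by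
  have hset : (σ.2.erase k)ᶜ = τ.2 ↔ τ.2.erase k = σ.2ᶜ := by
    simp only [Finset.ext_iff, Finset.mem_compl, Finset.mem_erase]
    refine forall_congr' fun j => ?_
    by_cases hj : j = k
    · subst hj; simp [hσ, hτ]
    · simp [hj, iff_comm]
  simp only [dualPlaquette, Plaquette.upper, Plaquette.lower, Prod.ext_iff, hset]
  refine and_congr_left fun _ => ?_
  simp only [funext_iff]
  refine forall_congr' fun j => ?_
  by_cases hj : j = k
  · subst hj; simp [hσ, sub_eq_iff_eq_add, eq_comm]
  · simp [hj, eq_comm]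

section Pairing

variable (F : Type*) [Field F] {d N : ℕ} [NeZero N]

/-- The sign of a set of directions in the intersection pairing. It is chosen such that the boundary
operator is self-adjoint, see `intersectionForm_boundary`. -/
def dualSign (S : Finset (Fin d)) : F := (-1) ^ ∑ j ∈ S, ((j : ℕ) + 1)

theorem dualSign_ne_zero (S : Finset (Fin d)) : dualSign F S ≠ 0 :=
  pow_ne_zero _ (neg_ne_zero.2 one_ne_zero)

/-- The intersection pairing of chains of `T^d_N` with chains of the dual complex: a plaquette meets
its dual plaquette with intersection number `±1`, and is disjoint from all other plaquettes of
complementary dimension. -/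
def intersectionForm : LinearMap.BilinForm F (Plaquette d N → F) :=
  LinearMap.mk₂ F (fun a c => ∑ σ, dualSign F σ.2 * a σ * c (dualPlaquette σ))
    (fun a b c => by simp [mul_add, add_mul, Finset.sum_add_distrib])
    (fun r a c => by
      simp only [Pi.smul_apply, smul_eq_mul, Finset.mul_sum]
      exact Finset.sum_congr rfl fun _ _ => by ring)
    (fun a b c => by simp [mul_add, Finset.sum_add_distrib])
    (fun r a c => by
      simp only [Pi.smul_apply, smul_eq_mul, Finset.mul_sum]
      exact Finset.sum_congr rfl fun _ _ => by ring)

theorem intersectionForm_apply (a c : Plaquette d N → F) :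
    intersectionForm F a c = ∑ σ, dualSign F σ.2 * a σ * c (dualPlaquette σ) := rfl

theorem intersectionForm_single_left (σ : Plaquette d N) (c : Plaquette d N → F) :
    intersectionForm F (Pi.single σ 1) c = dualSign F σ.2 * c (dualPlaquette σ) := by
  rw [intersectionForm_apply, Finset.sum_eq_single σ] <;> simp +contextual

theorem intersectionForm_single_right (a : Plaquette d N → F) (τ : Plaquette d N) :
    intersectionForm F a (Pi.single τ 1) =
      dualSign F (primalPlaquette τ).2 * a (primalPlaquette τ) := by
  rw [intersectionForm_apply, Finset.sum_eq_single (primalPlaquette τ)]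
  · simp [dualPlaquette_primalPlaquette]
  · intro σ _ hσ
    rw [Pi.single_eq_of_ne, mul_zero]
    rwa [Ne, dualPlaquette_eq_iff]
  · simp

theorem ker_intersectionForm : (intersectionForm F (d := d) (N := N)).ker = ⊥ := by
  refine (Submodule.eq_bot_iff _).2 fun a ha => funext fun σ => ?_
  have h := LinearMap.congr_fun (LinearMap.mem_ker.1 ha) (Pi.single (dualPlaquette σ) 1)
  rw [intersectionForm_single_right, primalPlaquette_dualPlaquette] at h
  exact (mul_eq_zero.1 h).resolve_left (dualSign_ne_zero F _)

/-- The signs of `k` as a direction of a plaquette and of the dual of its face have the product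
`(-1) ^ k`, as each direction below `k` belongs to exactly one of the two. The minus sign
compensates for the exchange of upper and lower faces. -/
theorem dualSign_erase {S T : Finset (Fin d)} {k : Fin d} (hS : k ∈ S) (hT : T = (S.erase k)ᶜ) :
    (-1 : F) ^ (S.filter (· < k)).card * dualSign F (S.erase k) =
      -(dualSign F S * (-1) ^ (T.filter (· < k)).card) := by
  have hk : (S.filter (· < k)).card + (T.filter (· < k)).card = k := by
    rw [← Finset.card_union_of_disjoint, ← Finset.filter_union]
    · conv_rhs => rw [← Fin.card_Iio k]
      congr 1
      ext j
      simp only [hT, Finset.mem_filter, Finset.mem_union, Finset.mem_compl, Finset.mem_erase,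
        Finset.mem_Iio]
      tauto
    · rw [Finset.disjoint_left]
      intro j h1 h2
      simp only [hT, Finset.mem_filter, Finset.mem_compl, Finset.mem_erase] at h1 h2
      exact h2.1 ⟨h2.2.ne, h1.1⟩
  rw [dualSign, dualSign, ← Finset.sum_erase_add _ _ hS, pow_add, ← hk, pow_add, pow_add]
  have h1 : ((-1 : F) ^ (T.filter (· < k)).card) ^ 2 = 1 := by
    rw [← pow_mul, mul_comm, pow_mul]; simp
  linear_combination -((-1 : F) ^ (S.filter (· < k)).card *
    (-1) ^ ∑ j ∈ S.erase k, ((j : ℕ) + 1)) * h1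

/-- The boundary operator of `T^d_N` is adjoint to the boundary operator of the dual complex: under
the intersection pairing, boundaries of the dual complex are coboundaries. -/
theorem intersectionForm_boundary (a c : Plaquette d N → F) :
    intersectionForm F (boundary F a) c = intersectionForm F a (boundary F c) := by
  suffices h : (intersectionForm F).comp (boundary F) LinearMap.id =
      (intersectionForm F (d := d) (N := N)).comp LinearMap.id (boundary F) by
    simpa using LinearMap.congr_fun₂ h a c
  refine LinearMap.pi_ext' fun σ => LinearMap.ext_ring <| LinearMap.pi_ext' fun τ =>
    LinearMap.ext_ring ?_
  simp only [LinearMap.comp_apply, LinearMap.single_apply, LinearMap.BilinForm.comp_apply,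
    LinearMap.id_apply, boundary_single]
  simp only [plaquetteBoundary, map_sum, map_smul, map_sub, LinearMap.sum_apply,
    LinearMap.smul_apply, LinearMap.sub_apply, intersectionForm_single_left, smul_eq_mul]
  rw [← Finset.sum_filter_of_ne (p := (· ∈ τ.2)),
    ← Finset.sum_filter_of_ne (s := τ.2) (p := (· ∈ σ.2))]
  · have hst : σ.2.filter (· ∈ τ.2) = τ.2.filter (· ∈ σ.2) := by
      ext j; simp [and_comm]
    rw [hst]
    refine Finset.sum_congr rfl fun k hk => ?_
    obtain ⟨hτ, hσ⟩ := Finset.mem_filter.1 hk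
    simp only [Pi.single_apply, dualPlaquette_upper_eq_iff hσ hτ,
      dualPlaquette_lower_eq_iff hσ hτ, @eq_comm _ (dualPlaquette σ)]
    by_cases hT : τ.2 = (σ.2.erase k)ᶜ
    · have := dualSign_erase F hσ hT
      rw [show (σ.upper k).2 = σ.2.erase k from rfl, show (σ.lower k).2 = σ.2.erase k from rfl]
      by_cases h1 : τ.lower k = dualPlaquette σ <;> by_cases h2 : τ.upper k = dualPlaquette σ <;>
        simp only [h1, h2, if_true, if_false]
      · ring
      · linear_combination this
      · linear_combination -this
      · ring
    · have h0 : τ.2.erase k ≠ (dualPlaquette σ).2 := by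
        intro h
        apply hT
        rw [← Finset.insert_erase hτ, h]
        simp [dualPlaquette, Finset.compl_erase]
      have h1 : τ.lower k ≠ dualPlaquette σ := fun h => h0 (congrArg Prod.snd h)
      have h2 : τ.upper k ≠ dualPlaquette σ := fun h => h0 (congrArg Prod.snd h)
      simp [h1, h2]
  · intro k hk h
    by_contra hσ
    have h0 : (dualPlaquette σ).2 ≠ τ.2.erase k := fun h =>
      Finset.notMem_erase k τ.2 (h ▸ by simp [dualPlaquette, hσ])
    have h1 : dualPlaquette σ ≠ τ.lower k := fun h => h0 (congrArg Prod.snd h)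
    have h2 : dualPlaquette σ ≠ τ.upper k := fun h => h0 (congrArg Prod.snd h)
    simp [h1, h2] at h
  · intro k hk h
    by_contra hτ
    have h1 : dualPlaquette (σ.lower k) ≠ τ := by
      rintro rfl; simp [dualPlaquette, Plaquette.lower] at hτ
    have h2 : dualPlaquette (σ.upper k) ≠ τ := by
      rintro rfl; simp [dualPlaquette, Plaquette.upper] at hτ
    simp [h1, h2] at h

end Pairing

/-! ### Orthogonal complements of chains, cycles and boundaries -/

theorem orthogonal_sup {F V : Type*} [Field F] [AddCommGroup V] [Module F V]
    (B : LinearMap.BilinForm F V) (W₁ W₂ : Submodule F V) :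
    B.orthogonal (W₁ ⊔ W₂) = B.orthogonal W₁ ⊓ B.orthogonal W₂ := by
  refine le_antisymm (le_inf (LinearMap.BilinForm.orthogonal_le le_sup_left)
    (LinearMap.BilinForm.orthogonal_le le_sup_right)) fun c hc a ha => ?_
  obtain ⟨x, hx, y, hy, rfl⟩ := Submodule.mem_sup.1 ha
  have h1 : B x c = 0 := hc.1 x hx
  have h2 : B y c = 0 := hc.2 y hy
  change B (x + y) c = 0
  rw [map_add, LinearMap.add_apply, h1, h2, add_zero]

section Duality

variable (F : Type*) [Field F] {d N : ℕ}

/-- Chains without a component of dimension `k`: the standard complement of the `k`-chains. -/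
def chainsNe (d N k : ℕ) : Submodule F (Plaquette d N → F) where
  carrier := {c | ∀ σ, c σ ≠ 0 → σ.dim ≠ k}
  zero_mem' _ h := absurd rfl h
  add_mem' {a b} ha hb σ h := by
    by_cases h0 : a σ = 0
    · exact hb σ (by simpa [h0] using h)
    · exact ha σ h0
  smul_mem' _ _ ha σ h := ha σ (right_ne_zero_of_mul h)

theorem chains_inf_chainsNe (X : Subcomplex d N) (k : ℕ) :
    chains F X k ⊓ chainsNe F d N k = ⊥ := by
  refine (Submodule.eq_bot_iff _).2 fun c hc => funext fun σ => ?_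
  by_contra h
  exact hc.2 σ h (hc.1 σ h).2

theorem chains_full_sup_chainsNe (k : ℕ) :
    chains F (fullComplex d N) k ⊔ chainsNe F d N k = ⊤ := by
  refine (Submodule.eq_top_iff').2 fun c => Submodule.mem_sup.2
    ⟨fun σ => if σ.dim = k then c σ else 0, fun σ h => ⟨trivial, ?_⟩,
      fun σ => if σ.dim = k then 0 else c σ, fun σ h => ?_, ?_⟩
  · by_contra h0; simp [h0] at h
  · intro h0; simp [h0] at h
  · ext σ; by_cases h : σ.dim = k <;> simp [h]

variable [NeZero N]

theorem finrank_add_finrank_orthogonal_intersectionForm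
    (W : Submodule F (Plaquette d N → F)) :
    Module.finrank F W + Module.finrank F ((intersectionForm F).orthogonal W) =
      Module.finrank F (Plaquette d N → F) := by
  have h := LinearMap.BilinForm.finrank_add_finrank_orthogonal' (B := intersectionForm F) W
  rwa [ker_intersectionForm, inf_bot_eq, finrank_bot, add_zero] at h

theorem finrank_chains_full_add (k : ℕ) :
    Module.finrank F (chains F (fullComplex d N) k) + Module.finrank F (chainsNe F d N k) =
      Module.finrank F (Plaquette d N → F) := by
  have h := Submodule.finrank_sup_add_finrank_inf_eq (chains F (fullComplex d N) k)
    (chainsNe F d N k)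
  rw [chains_inf_chainsNe, chains_full_sup_chainsNe, finrank_bot, add_zero, finrank_top] at h
  exact h.symm

theorem intersectionForm_eq_zero_of_dim {k l : ℕ} (hkl : k + l = d) {a c : Plaquette d N → F}
    (ha : a ∈ chainsNe F d N k) (hc : c ∈ chains F (fullComplex d N) l) :
    intersectionForm F a c = 0 := by
  rw [intersectionForm_apply]
  refine Finset.sum_eq_zero fun σ _ => ?_
  by_contra h
  have h1 := ha σ (right_ne_zero_of_mul (left_ne_zero_of_mul h))
  have h2 := (hc _ (right_ne_zero_of_mul h)).2
  have h3 := dim_add_dim_dualPlaquette σ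
  omega

/-- The annihilator of the chains without a component of dimension `k` consists of the chains of
dimension `d - k`. -/
theorem orthogonal_chainsNe {k l : ℕ} (hkl : k + l = d) :
    (intersectionForm F).orthogonal (chainsNe F d N k) = chains F (fullComplex d N) l := by
  refine le_antisymm (fun c hc τ hτ => ⟨trivial, ?_⟩)
    fun c hc a ha => intersectionForm_eq_zero_of_dim F hkl ha hc
  by_contra h
  have h1 : intersectionForm F (Pi.single (primalPlaquette τ) 1) c = 0 := by
    refine hc _ fun σ hσ => ?_
    obtain rfl : σ = primalPlaquette τ := by
      by_contra h0; simp [h0] at hσ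
    have := dim_add_dim_primalPlaquette τ
    omega
  rw [intersectionForm_single_left, dualPlaquette_primalPlaquette] at h1
  exact (mul_ne_zero (dualSign_ne_zero F _) hτ) h1

/-- The pairing of `k`-chains with `(d - k)`-chains is perfect. -/
theorem finrank_add_finrank_orthogonal_inf_chains {k l : ℕ} (hkl : k + l = d)
    {W : Submodule F (Plaquette d N → F)} (hW : W ≤ chains F (fullComplex d N) k) :
    Module.finrank F W + Module.finrank F
      ((intersectionForm F).orthogonal W ⊓ chains F (fullComplex d N) l : Submodule F _) =
      Module.finrank F (chains F (fullComplex d N) k) := by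
  have h1 := finrank_add_finrank_orthogonal_intersectionForm F (W ⊔ chainsNe F d N k)
  have h2 : (intersectionForm F).orthogonal (W ⊔ chainsNe F d N k) =
      (intersectionForm F).orthogonal W ⊓ chains F (fullComplex d N) l := by
    rw [← orthogonal_chainsNe F hkl, orthogonal_sup]
  have h3 := Submodule.finrank_sup_add_finrank_inf_eq W (chainsNe F d N k)
  have h4 : W ⊓ chainsNe F d N k = ⊥ :=
    le_bot_iff.1 ((inf_le_inf_right _ hW).trans_eq (chains_inf_chainsNe F _ k))
  rw [h4, finrank_bot] at h3
  have h5 := finrank_chains_full_add F (d := d) (N := N) k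
  rw [h2] at h1
  omega

theorem finrank_chains_full_eq {k l : ℕ} (hkl : k + l = d) :
    Module.finrank F (chains F (fullComplex d N) l) =
      Module.finrank F (chains F (fullComplex d N) k) := by
  have h := finrank_add_finrank_orthogonal_inf_chains F (N := N) hkl (W := ⊥) bot_le
  have h0 : (intersectionForm F (d := d) (N := N)).orthogonal ⊥ = ⊤ :=
    (Submodule.eq_top_iff').2 fun c a ha => by
      rw [(Submodule.mem_bot F).1 ha]; exact LinearMap.BilinForm.zero_left c
  rwa [h0, top_inf_eq, finrank_bot, zero_add] at h

/-- The common annihilator of two spaces of `k`-chains is the annihilator of their sum, so its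
dimension is determined by those of the two spaces and of their intersection. -/
theorem finrank_inf_orthogonal_inf_orthogonal {k l : ℕ} (hkl : k + l = d)
    {W₁ W₂ : Submodule F (Plaquette d N → F)} (h₁ : W₁ ≤ chains F (fullComplex d N) k)
    (h₂ : W₂ ≤ chains F (fullComplex d N) k) :
    Module.finrank F (((intersectionForm F).orthogonal W₁ ⊓ chains F (fullComplex d N) l) ⊓
      ((intersectionForm F).orthogonal W₂ ⊓ chains F (fullComplex d N) l) : Submodule F _) +
      Module.finrank F W₁ + Module.finrank F W₂ =
      Module.finrank F (chains F (fullComplex d N) k) +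
        Module.finrank F (W₁ ⊓ W₂ : Submodule F _) := by
  have h := finrank_add_finrank_orthogonal_inf_chains F hkl (sup_le h₁ h₂)
  have h3 := Submodule.finrank_sup_add_finrank_inf_eq W₁ W₂
  rw [← inf_inf_distrib_right, ← orthogonal_sup]
  omega

/-- The chains of the dual complex are the annihilator of the chains of the complex. -/
theorem chains_dual (X : Subcomplex d N) {k l : ℕ} (hkl : k + l = d) :
    chains F X.dual l =
      (intersectionForm F).orthogonal (chains F X k) ⊓ chains F (fullComplex d N) l := by
  apply le_antisymm
  · refine fun c hc => ⟨fun a ha => ?_, fun τ hτ => ⟨trivial, (hc τ hτ).2⟩⟩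
    show intersectionForm F a c = 0
    rw [intersectionForm_apply]
    refine Finset.sum_eq_zero fun σ _ => ?_
    by_contra h
    have h1 := (ha σ (right_ne_zero_of_mul (left_ne_zero_of_mul h))).1
    have h2 : primalPlaquette (dualPlaquette σ) ∉ X.cells := (hc _ (right_ne_zero_of_mul h)).1
    rw [primalPlaquette_dualPlaquette] at h2
    exact h2 h1
  · intro c hc τ hτ
    have hdim := (hc.2 τ hτ).2
    refine ⟨fun hmem => ?_, hdim⟩
    have h1 : intersectionForm F (Pi.single (primalPlaquette τ) 1) c = 0 := by
      refine hc.1 _ fun σ hσ => ?_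
      obtain rfl : σ = primalPlaquette τ := by
        by_contra h0; simp [h0] at hσ
      have := dim_add_dim_primalPlaquette τ
      exact ⟨hmem, by omega⟩
    rw [intersectionForm_single_left, dualPlaquette_primalPlaquette] at h1
    exact (mul_ne_zero (dualSign_ne_zero F _) hτ) h1

theorem boundaries_le_chains (X : Subcomplex d N) (k : ℕ) : boundaries F X k ≤ chains F X k :=
  (boundaries_le_cycles F X k).trans inf_le_left

/-- Cycles of the dual torus are the chains that pair to zero with all boundaries: by adjointness
the latter means that the boundary of the chain pairs to zero with all plaquettes. -/
theorem cycles_full_eq {k l : ℕ} (hkl : k + l = d) :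
    cycles F (fullComplex d N) l = (intersectionForm F).orthogonal
      (boundaries F (fullComplex d N) k) ⊓ chains F (fullComplex d N) l := by
  apply le_antisymm
  · refine fun c hc => ⟨?_, hc.1⟩
    rintro _ ⟨a, -, rfl⟩
    show intersectionForm F (boundary F a) c = 0
    rw [intersectionForm_boundary, LinearMap.mem_ker.1 hc.2, map_zero]
  · refine fun c hc => ⟨hc.2, LinearMap.mem_ker.2 (funext fun τ => ?_)⟩
    by_contra h
    have hτ : τ.dim + 1 = l := by
      rcases l with - | l
      -- A `0`-chain has no boundary, although there is no degree `-1` for it to lie in.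
      · exfalso
        apply h
        have : boundary F c = 0 := by
          rw [boundary, Fintype.linearCombination_apply]
          refine Finset.sum_eq_zero fun σ _ => ?_
          by_cases hσ : c σ = 0
          · simp [hσ]
          · have := (hc.2 σ hσ).2
            rw [Plaquette.dim, Finset.card_eq_zero] at this
            simp [plaquetteBoundary, this]
        exact congrFun this τ
      · rw [(boundaries_le_chains F (fullComplex d N) l ⟨c, hc.2, rfl⟩ τ h).2]
    -- The coefficient of `τ` in the boundary of `c` is read off from the pairing with the plaquette
    -- that is dual to `τ`.
    have h1 : intersectionForm F (boundary F (Pi.single (primalPlaquette τ) 1)) c = 0 := by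
      refine hc.1 _ ⟨_, fun σ hσ => ⟨trivial, ?_⟩, rfl⟩
      obtain rfl : σ = primalPlaquette τ := by
        by_contra h0; simp [h0] at hσ
      have := dim_add_dim_primalPlaquette τ
      omega
    rw [intersectionForm_boundary, intersectionForm_single_left,
      dualPlaquette_primalPlaquette] at h1
    exact (mul_ne_zero (dualSign_ne_zero F _) h) h1

theorem finrank_boundaries_add_finrank_cycles (X : Subcomplex d N) (k : ℕ) :
    Module.finrank F (boundaries F X k) + Module.finrank F (cycles F X (k + 1)) =
      Module.finrank F (chains F X (k + 1)) := by
  have h := ((boundary F).domRestrict (chains F X (k + 1))).finrank_range_add_finrank_ker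
  have h1 : LinearMap.range ((boundary F).domRestrict (chains F X (k + 1))) =
      boundaries F X k := by
    rw [LinearMap.range_domRestrict]; rfl
  have h2 : (LinearMap.ker ((boundary F).domRestrict (chains F X (k + 1)))).map
      (chains F X (k + 1)).subtype = cycles F X (k + 1) := by
    rw [LinearMap.ker_domRestrict, Submodule.map_comap_subtype]; rfl
  rwa [h1, ← Submodule.finrank_map_subtype_eq, h2] at h

/-- Boundaries of the dual torus are the chains that pair to zero with all cycles. One inclusion is
the adjointness of the boundary operators, the other one follows from a count of dimensions. -/
theorem boundaries_full_eq {k l : ℕ} (hkl : k + l = d) (hk : 1 ≤ k) :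
    boundaries F (fullComplex d N) l = (intersectionForm F).orthogonal
      (cycles F (fullComplex d N) k) ⊓ chains F (fullComplex d N) l := by
  refine Submodule.eq_of_le_of_finrank_eq (le_inf ?_ (boundaries_le_chains F _ l)) ?_
  · rintro _ ⟨c, -, rfl⟩ a ha
    show intersectionForm F a (boundary F c) = 0
    rw [← intersectionForm_boundary, LinearMap.mem_ker.1 ha.2, map_zero, LinearMap.zero_apply]
  · obtain ⟨k, rfl⟩ := Nat.exists_eq_add_of_le' hk
    have hkl' : k + (l + 1) = d := by omega
    have h1 := finrank_add_finrank_orthogonal_inf_chains F hkl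
      (W := cycles F (fullComplex d N) (k + 1)) inf_le_left
    have h2 := finrank_add_finrank_orthogonal_inf_chains F hkl'
      (boundaries_le_chains F (fullComplex d N) k)
    rw [← cycles_full_eq F hkl'] at h2
    have h3 := finrank_boundaries_add_finrank_cycles F (fullComplex d N) k
    have h4 := finrank_boundaries_add_finrank_cycles F (fullComplex d N) l
    have h5 := finrank_chains_full_eq F (N := N) hkl'
    omega

/-! ### Betti numbers and giant cycles of the dual complex -/

theorem betti_add_finrank_boundaries (X : Subcomplex d N) (k : ℕ) :
    betti F X k + Module.finrank F (boundaries F X k) = Module.finrank F (cycles F X k) := by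
  have h := Submodule.finrank_quotient_add_finrank
    ((boundaries F X k).submoduleOf (cycles F X k))
  rwa [(Submodule.submoduleOfEquivOfLe (boundaries_le_cycles F X k)).finrank_eq] at h

theorem chains_inf_cycles_full (X : Subcomplex d N) (k : ℕ) :
    chains F X k ⊓ cycles F (fullComplex d N) k = cycles F X k :=
  le_antisymm (fun _ hc => ⟨hc.1, hc.2.2⟩)
    fun _ hc => ⟨hc.1, cycles_mono F (Set.subset_univ _) k hc⟩

/-- The kernel of `H_k(X) → H_k(T^d_N)` consists of the classes of those chains of `X` that are
boundaries in `T^d_N`. -/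
theorem giantRank_add_finrank (X : Subcomplex d N) (k : ℕ) :
    giantRank F X k + Module.finrank F
      (chains F X k ⊓ boundaries F (fullComplex d N) k : Submodule F _) =
      Module.finrank F (cycles F X k) := by
  set h := Set.subset_univ X.cells
  set B := (boundaries F (fullComplex d N) k).submoduleOf (cycles F (fullComplex d N) k)
  have hr := (B.mkQ ∘ₗ Submodule.inclusion
    (cycles_mono F (Y := fullComplex d N) h k)).finrank_range_add_finrank_ker
  have h1 : LinearMap.range (homologyMap F (Y := fullComplex d N) h k) =
      LinearMap.range (B.mkQ ∘ₗ Submodule.inclusion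
        (cycles_mono F (Y := fullComplex d N) h k)) := by
    rw [LinearMap.range_comp]
    exact Submodule.range_mapQ _ _ _ _
  have h2 : (LinearMap.ker (B.mkQ ∘ₗ Submodule.inclusion
      (cycles_mono F (Y := fullComplex d N) h k))).map (cycles F X k).subtype =
      chains F X k ⊓ boundaries F (fullComplex d N) k := by
    ext c
    simp only [Submodule.mem_map, LinearMap.mem_ker, LinearMap.comp_apply, Submodule.mkQ_apply,
      Submodule.Quotient.mk_eq_zero]
    constructor
    · rintro ⟨x, hx, rfl⟩
      exact ⟨x.2.1, hx⟩
    · rintro ⟨hc, hb⟩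
      exact ⟨⟨c, hc, (boundaries_le_cycles F _ k hb).2⟩, hb, rfl⟩
  rwa [← Submodule.finrank_map_subtype_eq, h2, ← h1] at hr

/-- The giant cycles of `X` and those of its dual complex have complementary ranks in the homology
of the torus. -/
theorem giantRank_add_giantRank_dual (X : Subcomplex d N) {k l : ℕ} (hkl : k + l = d)
    (hk : 1 ≤ k) :
    giantRank F X k + giantRank F X.dual l = betti F (fullComplex d N) k := by
  have hX : chains F X k ≤ chains F (fullComplex d N) k := chains_mono F (Set.subset_univ _) k
  have h1 := finrank_inf_orthogonal_inf_orthogonal F hkl hX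
    (boundaries_le_chains F (fullComplex d N) k)
  have h2 := finrank_inf_orthogonal_inf_orthogonal F hkl hX
    (W₂ := cycles F (fullComplex d N) k) inf_le_left
  rw [← chains_dual F X hkl, ← cycles_full_eq F hkl, chains_inf_cycles_full] at h1
  rw [← chains_dual F X hkl, ← boundaries_full_eq F hkl hk, chains_inf_cycles_full] at h2
  have h3 := giantRank_add_finrank F X k
  have h4 := giantRank_add_finrank F X.dual l
  have h5 := betti_add_finrank_boundaries F (fullComplex d N) k
  omega

/-- In a complex with all plaquettes of dimension `k`, the `k`-cycles are those of the torus. When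
the `(k + 1)`-plaquettes are added one at a time, each one either kills a homology class of
dimension `k` or creates a cycle of dimension `k + 1`. -/
theorem betti_add_finrank_chains (X : Subcomplex d N) (k : ℕ)
    (hX : ∀ σ : Plaquette d N, σ.dim = k → σ ∈ X.cells) :
    betti F X k + Module.finrank F (chains F X (k + 1)) =
      Module.finrank F (cycles F (fullComplex d N) k) +
        Module.finrank F (cycles F X (k + 1)) := by
  have h1 : cycles F X k = cycles F (fullComplex d N) k :=
    le_antisymm (cycles_mono F (Set.subset_univ _) k)
      fun c hc => ⟨fun σ hσ => ⟨hX σ (hc.1 σ hσ).2, (hc.1 σ hσ).2⟩, hc.2⟩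
  have h2 := betti_add_finrank_boundaries F X k
  have h3 := finrank_boundaries_add_finrank_cycles F X k
  rw [h1] at h2
  omega

/-- If `X` and its dual complex have complete skeleta of dimensions `k` and `l = d - k - 2`, then up
to a constant that does not depend on `X`, the Betti number of the dual complex is the one of `X`,
plus the number of `(k + 1)`-plaquettes of `X`, minus the number of giant cycles of `X`. -/
theorem betti_dual_add_giantRank (X : Subcomplex d N) {k l : ℕ} (hkl : (k + 1) + (l + 1) = d)
    (hX : ∀ σ : Plaquette d N, σ.dim = k → σ ∈ X.cells)
    (hX' : ∀ σ : Plaquette d N, σ.dim = l → σ ∈ X.dual.cells) :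
    betti F X.dual l + giantRank F X (k + 1) +
      Module.finrank F (boundaries F (fullComplex d N) (k + 1)) +
        Module.finrank F (cycles F (fullComplex d N) k) =
      betti F X k + Module.finrank F (chains F X (k + 1)) +
        Module.finrank F (cycles F (fullComplex d N) l) := by
  have hC : chains F X (k + 1) ≤ chains F (fullComplex d N) (k + 1) :=
    chains_mono F (Set.subset_univ _) _
  have h1 := finrank_inf_orthogonal_inf_orthogonal F hkl hC
    (boundaries_le_chains F (fullComplex d N) (k + 1))
  rw [← chains_dual F X hkl, ← cycles_full_eq F hkl, chains_inf_cycles_full] at h1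
  have h2 := finrank_add_finrank_orthogonal_inf_chains F hkl hC
  rw [← chains_dual F X hkl] at h2
  have h3 := giantRank_add_finrank F X (k + 1)
  have h4 := betti_add_finrank_chains F X k hX
  have h5 := betti_add_finrank_chains F X.dual l hX'
  omega

end Duality

/-! ### Configurations and their weights -/

section Configurations

variable {d N : ℕ}

/-- Duality as a bijection between the `i`-plaquettes and the `(d - i)`-plaquettes. -/
def faceDual {i l : ℕ} (h : i + l = d) : Face d N i ≃ Face d N l where
  toFun σ := ⟨dualPlaquette σ.1, by have := dim_add_dim_dualPlaquette σ.1; have := σ.2; omega⟩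
  invFun τ := ⟨primalPlaquette τ.1, by have := dim_add_dim_primalPlaquette τ.1; have := τ.2; omega⟩
  left_inv σ := Subtype.ext (primalPlaquette_dualPlaquette σ.1)
  right_inv τ := Subtype.ext (dualPlaquette_primalPlaquette τ.1)

theorem finrank_chains_complexOf (F : Type*) [Field F] {i : ℕ} (ω : Finset (Face d N i)) :
    Module.finrank F (chains F (complexOf ω) i) = ω.card := by
  classical
  have hmem : ∀ σ : Face d N i, σ.1 ∈ (complexOf ω).cells ↔ σ ∈ ω := fun σ =>
    ⟨by
      rintro (h | ⟨τ, hτ, he⟩)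
      · exact absurd σ.2 h.ne
      · rwa [← Subtype.ext he],
      fun h => Or.inr ⟨σ, h, rfl⟩⟩
  let e : chains F (complexOf ω) i ≃ₗ[F] (ω → F) :=
    { toFun := fun c σ => c.1 σ.1.1
      map_add' := fun _ _ => rfl
      map_smul' := fun _ _ => rfl
      invFun := fun f => ⟨fun σ => if h : ∃ hσ : σ.dim = i, (⟨σ, hσ⟩ : Face d N i) ∈ ω then
          f ⟨⟨σ, h.1⟩, h.2⟩ else 0, fun σ hσ => by
        by_cases h : ∃ hσ : σ.dim = i, (⟨σ, hσ⟩ : Face d N i) ∈ ω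
        · exact ⟨(hmem ⟨σ, h.1⟩).2 h.2, h.1⟩
        · simp [h] at hσ⟩
      left_inv := fun c => by
        ext σ
        by_cases h : ∃ hσ : σ.dim = i, (⟨σ, hσ⟩ : Face d N i) ∈ ω
        · simp [h]
        · have : c.1 σ = 0 := by
            by_contra h0
            have := c.2 σ h0
            exact h ⟨this.2, (hmem ⟨σ, this.2⟩).1 this.1⟩
          simp [h, this]
      right_inv := fun f => by
        ext σ
        have h : ∃ hσ : σ.1.1.dim = i, (⟨σ.1.1, hσ⟩ : Face d N i) ∈ ω := ⟨σ.1.2, σ.2⟩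
        exact dif_pos h }
  rw [e.finrank_eq, Module.finrank_fintype_fun_eq_card, Fintype.card_coe]

variable [NeZero N]

/-- The dual configuration: a plaquette is open if its dual plaquette is closed. -/
def dualConfig {i l : ℕ} (h : i + l = d) : Finset (Face d N i) ≃ Finset (Face d N l) :=
  compl_involutive.toPerm.trans (faceDual h).finsetCongr

theorem mem_dualConfig {i l : ℕ} (h : i + l = d) (ω : Finset (Face d N i)) (τ : Face d N l) :
    τ ∈ dualConfig h ω ↔ (faceDual h).symm τ ∉ ω := by
  simp [dualConfig, Finset.mem_map_equiv]

theorem card_add_card_dualConfig {i l : ℕ} (h : i + l = d) (ω : Finset (Face d N i)) :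
    ω.card + (dualConfig h ω).card = Fintype.card (Face d N i) := by
  simp [dualConfig, Finset.card_add_card_compl]

theorem dual_complexOf {i l : ℕ} (h : i + l = d) (ω : Finset (Face d N i)) :
    (complexOf ω).dual = complexOf (dualConfig h ω) := by
  ext τ
  have hd := dim_add_dim_primalPlaquette τ
  change ¬((primalPlaquette τ).dim < i ∨ ∃ σ ∈ ω, σ.1 = primalPlaquette τ) ↔
    (τ.dim < l ∨ ∃ σ ∈ dualConfig h ω, σ.1 = τ)
  rcases lt_trichotomy τ.dim l with hl | hl | hl
  · simp only [hl, true_or, iff_true, not_or]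
    refine ⟨by omega, ?_⟩
    rintro ⟨σ, -, hσ⟩
    have := σ.2
    rw [hσ] at this
    omega
  · have h1 : (∃ σ ∈ dualConfig h ω, σ.1 = τ) ↔ (⟨τ, hl⟩ : Face d N l) ∈ dualConfig h ω :=
      ⟨by rintro ⟨σ, hσ, rfl⟩; exact hσ, fun hτ => ⟨_, hτ, rfl⟩⟩
    have h2 : (∃ σ ∈ ω, σ.1 = primalPlaquette τ) ↔ (faceDual h).symm ⟨τ, hl⟩ ∈ ω :=
      ⟨by
        rintro ⟨σ, hσ, he⟩
        rwa [show (faceDual h).symm ⟨τ, hl⟩ = σ from Subtype.ext he.symm],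
        fun hτ => ⟨_, hτ, rfl⟩⟩
    rw [h1, h2, mem_dualConfig]
    have h3 : ¬ (primalPlaquette τ).dim < i := by omega
    simp [h3, hl]
  · refine iff_of_false (fun hn => hn (Or.inl (by omega))) ?_
    rintro (h1 | ⟨σ, -, rfl⟩)
    · omega
    · exact hl.ne' σ.2

/-- Up to a constant factor, the dual configuration has the weight of the original one. The two
powers of `√q` are complementary by `giantRank_add_giantRank_dual`, and the surplus factor
`√q ^ b * √q ^ b = q ^ b` is the one that `betti_dual_add_giantRank` asks for. -/
theorem balancedWeight_dualConfig (F : Type*) [Field F] {k m : ℕ} (h : (k + 1) + (m + 1) = d)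
    {p q : ℝ} (hp : p ∈ Set.Icc (0 : ℝ) 1) (hq : 0 < q) :
    ∃ C : ℝ, 0 < C ∧ ∀ ω : Finset (Face d N (k + 1)),
      balancedWeight F (dualParam p q) q (dualConfig h ω) = C * balancedWeight F p q ω := by
  have hs : 0 < √q := Real.sqrt_pos.2 hq
  have hD : 0 < (1 - p) * q + p := by
    rcases hp.1.eq_or_lt with rfl | h0
    · simpa using hq
    · exact add_pos_of_nonneg_of_pos (mul_nonneg (sub_nonneg.2 hp.2) hq.le) h0
  refine ⟨(√q)⁻¹ ^ betti F (fullComplex d N) (k + 1) *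
    (q / ((1 - p) * q + p)) ^ Fintype.card (Face d N (k + 1)) *
    q ^ Module.finrank F (cycles F (fullComplex d N) m) /
      q ^ (Module.finrank F (boundaries F (fullComplex d N) (k + 1)) +
        Module.finrank F (cycles F (fullComplex d N) k)), by positivity, fun ω => ?_⟩
  have hcard := card_add_card_dualConfig h ω
  have hcard' : Fintype.card (Face d N (m + 1)) = Fintype.card (Face d N (k + 1)) :=
    (Fintype.card_congr (faceDual h)).symm
  have hgiant := giantRank_add_giantRank_dual F (complexOf ω) h (Nat.le_add_left 1 k)
  have hbetti := betti_dual_add_giantRank F (complexOf ω) h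
    (fun σ hσ => Or.inl (hσ.trans_lt k.lt_succ_self))
    (fun σ hσ => by
      rw [dual_complexOf h]
      exact Or.inl (hσ.trans_lt m.lt_succ_self))
  rw [dual_complexOf h] at hgiant hbetti
  rw [finrank_chains_complexOf] at hbetti
  unfold balancedWeight
  rw [Nat.add_sub_cancel, Nat.add_sub_cancel, hcard',
    show Fintype.card (Face d N (k + 1)) - (dualConfig h ω).card = ω.card by omega,
    show Fintype.card (Face d N (k + 1)) - ω.card = (dualConfig h ω).card by omega,
    ← hgiant, ← hcard]
  -- The probability that a plaquette is closed in the dual model.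
  have hp' : 1 - dualParam p q = p / ((1 - p) * q + p) := by
    rw [dualParam, eq_div_iff hD.ne', sub_mul, div_mul_cancel₀ _ hD.ne']; ring
  rw [hp', dualParam]
  generalize giantRank F (complexOf ω) (k + 1) = b at *
  generalize betti F (complexOf (dualConfig h ω)) m = β' at *
  generalize betti F (complexOf ω) k = β at *
  have hpow : q ^ β' * (√q ^ b * √q ^ b) *
      q ^ (Module.finrank F (boundaries F (fullComplex d N) (k + 1)) +
        Module.finrank F (cycles F (fullComplex d N) k)) =
      q ^ β * q ^ ω.card * q ^ Module.finrank F (cycles F (fullComplex d N) m) := by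
    rw [← mul_pow, Real.mul_self_sqrt hq.le, ← pow_add, ← pow_add, ← pow_add, ← pow_add,
      ← add_assoc, hbetti]
  have hinv : (√q)⁻¹ ^ b * √q ^ b = 1 := by rw [← mul_pow, inv_mul_cancel₀ hs.ne', one_pow]
  have hQ : 0 < q ^ (Module.finrank F (boundaries F (fullComplex d N) (k + 1)) +
        Module.finrank F (cycles F (fullComplex d N) k)) := by positivity
  generalize q ^ (Module.finrank F (boundaries F (fullComplex d N) (k + 1)) +
        Module.finrank F (cycles F (fullComplex d N) k)) = Q at hpow hQ ⊢
  have hβ' : q ^ β' = (√q)⁻¹ ^ b * (√q)⁻¹ ^ b *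
      (q ^ β * q ^ ω.card * q ^ Module.finrank F (cycles F (fullComplex d N) m)) / Q := by
    rw [eq_div_iff hQ.ne']
    linear_combination (√q)⁻¹ ^ b * (√q)⁻¹ ^ b * hpow -
      q ^ β' * Q * ((√q)⁻¹ ^ b * √q ^ b + 1) * hinv
  rw [hβ']
  simp only [pow_add, div_pow, mul_pow]
  ring

end Configurations

/-! ### Transport of the probability distribution -/

/-- Proportional weights define the same probability distribution. -/
theorem normalize_map_equiv {α β : Type*} (e : α ≃ β) {f : α → ℝ≥0∞} {g : β → ℝ≥0∞} {c : ℝ≥0∞}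
    (hc0 : c ≠ 0) (hc : c ≠ ∞) (hfg : ∀ a, g (e a) = c * f a) (hf0 : tsum f ≠ 0) (hf : tsum f ≠ ∞)
    (hg0 : tsum g ≠ 0) (hg : tsum g ≠ ∞) :
    (PMF.normalize f hf0 hf).map e = PMF.normalize g hg0 hg := by
  ext b
  obtain ⟨a, rfl⟩ := e.surjective b
  have hsum : ∑' b, g b = c * ∑' a, f a := by
    rw [← e.tsum_eq g, ← ENNReal.tsum_mul_left]
    exact tsum_congr hfg
  rw [PMF.map_apply, tsum_eq_single a (fun a' ha' => if_neg fun he => ha' (e.injective he).symm),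
    if_pos rfl, PMF.normalize_apply, PMF.normalize_apply, hsum, hfg,
    ENNReal.mul_inv (Or.inl hc0) (Or.inl hc), mul_mul_mul_comm, ENNReal.mul_inv_cancel hc0 hc,
    one_mul]

end PlaquetteRC

end

theorem mainTheorem6 (F : Type*) [Field F] (d N i : ℕ) [NeZero N] (hi : 1 ≤ i) (hid : i < d)
    (p q : ℝ) (hp : p ∈ Set.Icc (0 : ℝ) 1) (hq : 0 < q) :
    (PlaquetteRC.balancedRCM F d N i p q hp hq).map PlaquetteRC.Subcomplex.dual =
      PlaquetteRC.balancedRCM F d N (d - i) (PlaquetteRC.dualParam p q) q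
        (PlaquetteRC.dualParam_mem hp hq) hq := by
  obtain ⟨k, rfl⟩ := Nat.exists_eq_add_of_le' hi
  obtain ⟨m, hm⟩ : ∃ m, d - (k + 1) = m + 1 := Nat.exists_eq_add_of_le' (by omega)
  rw [hm]
  have h : (k + 1) + (m + 1) = d := by omega
  obtain ⟨C, hC, hw⟩ := PlaquetteRC.balancedWeight_dualConfig (N := N) F h hp hq
  have hcomp : PlaquetteRC.Subcomplex.dual ∘ PlaquetteRC.complexOf =
      PlaquetteRC.complexOf ∘ PlaquetteRC.dualConfig (N := N) h :=
    funext fun ω => PlaquetteRC.dual_complexOf h ω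
  unfold PlaquetteRC.balancedRCM
  rw [PMF.map_comp, hcomp, ← PMF.map_comp]
  congr 1
  refine PlaquetteRC.normalize_map_equiv _ (ENNReal.ofReal_pos.2 hC).ne' ENNReal.ofReal_ne_top
    (fun ω => ?_) _ _ _ _
  rw [hw, ENNReal.ofReal_mul hC.le]
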